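/- **Definitions.** Let $X$ be a measurable space (the feature space). All functions $f:X\to\{-1,+1\}$ below are measurable. A hypothesis class is a set $\mathcal H$ of such functions; its VC-dimension is the supremum of the sizes of the finite sets $S\subseteq X$ on which every labelling $S\to\{-1,+1\}$ is realized by a member of $\mathcal H$. For a probability measure $\mathcal D$ on $X$ and a ground truth $h\in\mathcal H$, the risk of $f$ is $R_{\mathcal D,h}(f)=\mathbb P_{x\sim\mathcal D}[f(x)\ne h(x)]$. $EQ_{\mathcal D}(f)$ is the law of $x\sim\mathcal D$ conditioned on $f(x)\neq h(x)$ if $R_{\mathcal D,h}(f)>0$, and it is the deterministic answer "YES" (which is not a point of $X$) if $R_{\mathcal D,h}(f)=0$. An adversary $\mathbf A$ assigns to every $f$ and every $x\in X$ a (random) point $\mathbf A(f,x)\in X$, by a Markov kernel in $x$ for each $f$; $\mathbf A(f,EX_{\mathcal D})$ is the law of $\mathbf A(f,x)$ with $x\sim\mathcal D$. $\mathbf A$ is a strong adversary for $f$ if $\mathbf A(f,EX_{\mathcal D})=EQ_{\mathcal D}(f)$. In the adversarial learning game with $T$ rounds, in each round $t=1,\dots,T$ the learner $\mathbf L$ presents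 a function $f_t$, which depends only on $x_1,\dots,x_{t-1}$, and receives a point $x_t$ drawn, with fresh randomness, from $\mathbf A(f_t,EX_{\mathcal D})$. After round $T$ the learner declares a function $f$, which depends only on $x_1,\dots,x_T$. The learner knows $X$, $\mathcal H$ and $\varepsilon$ but not $\mathcal D$, $h$ or $\mathbf A$. Probabilities in the game are computed round by round: given the history, integrate over the law of the next answer (with lower integrals where the dependence on the history is not measurable). $\mathcal H$ is called sample-measurable for $\mathcal D$ if for every $n$ and every $b\in\{-1,+1\}^n$ the set $\{x\in X^n:\ \exists h'\in\mathcal H\ \forall i\ \ h'(x_i)=b_i\}$ is measurable for the completion of $\mathcal D^n$. (This is the usual measurability convention of VC theory; it always holds, for instance, if $\mathcal H$ is countable.) **Theorem.** There are universal constants $C>0$ and $k\in\mathbb N$ such that for every measurable space $X$, every $\varepsilon\in(0,\frac1{32})$, every $d\in\mathbb N$ and every hypothesis class $\mathcal H$ on $X$ of VC-dimension $d$ there is a (deterministic) learner $\mathbf L$ that plays $T\le C\,d\,(\log_2(1/\varepsilon))^k$ rounds and has the following two properties. 1. For every probability measure $\mathcal D$ on $X$ for which $\mathcal H$ is sample-measurable,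 every ground truth $h\in\mathcal H$ and every adversary $\mathbf A$: when $\mathbf L$ interacts with $\mathbf A$, then with probability at least $2/3$ at least one of the following holds: - the function $f$ that $\mathbf L$ declares after the $T$ rounds satisfies $R_{\mathcal D,h}(f)\le\varepsilon$; - there is a round $t\in\{1,\dots,T\}$ such that the function $f_t$ presented in it satisfies $\mathbf A(f_t,EX_{\mathcal D})\ne EQ_{\mathcal D}(f_t)$, i.e. $\mathbf A$ is not a strong adversary for $f_t$. 2. In every interaction, whatever the answers are, at most $C\,(\log_2(1/\varepsilon))^k$ different functions are presented to the adversary. -/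

import Mathlib

open MeasureTheory ProbabilityTheory
open scoped ENNReal

universe u

namespace AdvLearning

/-- A function `X → {-1,+1}`; the two labels are coded by `Bool`. As only functions with measurable
error sets have a risk, a classifier is measurable by definition. -/
abbrev Classifier (X : Type u) [MeasurableSpace X] : Type u :=
  {f : X → Bool // Measurable f}

section

variable {X : Type u} [MeasurableSpace X]

/-- `H` realizes every labelling of the finite set `S`. -/
def Shatters (H : Set (Classifier X)) (S : Finset X) : Prop :=
  ∀ b : X → Bool, ∃ h ∈ H, ∀ x ∈ S, h.1 x = b x

/-- The VC-dimension: the supremum of the sizes of the finite sets shattered by `H`. -/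
noncomputable def vcDim (H : Set (Classifier X)) : ℕ∞ :=
  ⨆ (S : Finset X) (_ : Shatters H S), (S.card : ℕ∞)

/-- The measurability convention of VC theory: for each labelling `b` of `n` points, the set of
`n`-tuples of points on which some member of `H` realizes `b` is measurable for (the completion of)
the law `Dⁿ` of an i.i.d. sample of size `n`. -/
def SampleMeasurable (H : Set (Classifier X)) (D : Measure X) : Prop :=
  ∀ (n : ℕ) (b : Fin n → Bool),
    NullMeasurableSet {x : Fin n → X | ∃ h ∈ H, ∀ i, h.1 (x i) = b i}
      (Measure.pi fun _ : Fin n => D)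

/-- The error set `{f ≠ h}`. -/
def errorSet (h f : Classifier X) : Set X := {x | f.1 x ≠ h.1 x}

/-- The risk of `f` for the distribution `D` and the ground truth `h`. -/
noncomputable def risk (D : Measure X) (h f : Classifier X) : ℝ := D.real (errorSet h f)

/-- The law of the answer of the equivalence query oracle to `f`: a point with law `D` conditioned
on the error set, or the answer "YES", coded as `Sum.inr ()`, when the risk of `f` is zero. -/
noncomputable def EQ (D : Measure X) (h f : Classifier X) : Measure (X ⊕ Unit) :=
  open Classical in
  if risk D h f = 0 then Measure.dirac (Sum.inr ())
  else (D[|errorSet h f]).map Sum.inl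

variable (X) in
/-- A (randomized, history-independent) adversary: `respond f x` is the law of the point that is
returned when the function `f` is attacked and the example query gave `x`. -/
structure Adversary where
  respond : Classifier X → Kernel X X
  markov : ∀ f, IsMarkovKernel (respond f)

/-- The law `A(f, EX_D)` on `X`: draw `x` from `D`, then return `A(f, x)`. -/
noncomputable def Adversary.attack (A : Adversary X) (D : Measure X) (f : Classifier X) :
    Measure X :=
  D.bind (A.respond f)

/-- `A` is a strong adversary for `f`: `A(f, EX_D)` and `EQ_D(f)` are the same distribution. -/
def Adversary.IsStrong (A : Adversary X) (D : Measure X) (h f : Classifier X) : Prop :=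
  (A.attack D f).map Sum.inl = EQ D h f

variable (X) in
/-- A deterministic learner for the adversarial learning game: the number of rounds that it plays,
the function it presents after having received the list of answers `w` (oldest first), and the
function it declares at the end. -/
structure Learner where
  rounds : ℕ
  query : List X → Classifier X
  output : List X → Classifier X

/-- The functions presented to the adversary in an interaction whose list of answers is `w`:
in round `t + 1` the learner has seen the first `t` answers. -/
def Learner.presented (L : Learner X) (w : List X) : Set (Classifier X) :=
  (fun t => L.query (w.take t)) '' Set.Iio L.rounds

/-- The probability that, when `n` more rounds are played after the answers `w`, the full list of
answers satisfies `E`. In each round the answer is drawn from `A(f, EX_D)` for the currently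
presented `f`, with fresh randomness. (`∫⁻` is the lower integral, so a function of the history
that is not measurable is never given more than its inner probability.) -/
noncomputable def gameProbFrom (L : Learner X) (A : Adversary X) (D : Measure X)
    (E : List X → Prop) : ℕ → List X → ℝ≥0∞
  | 0, w => open Classical in if E w then 1 else 0
  | n + 1, w => ∫⁻ x, gameProbFrom L A D E n (w ++ [x]) ∂(A.attack D (L.query w))

/-- The probability that the list of all answers of the game between `L` and `A` satisfies `E`. -/
noncomputable def gameProb (L : Learner X) (A : Adversary X) (D : Measure X)
    (E : List X → Prop) : ℝ≥0∞ :=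
  gameProbFrom L A D E L.rounds []

end

end AdvLearning

/-! The learner only sees errors of the functions that it presents. While the adversary is strong,
each answer `x` to `f` is a point of the error set of `f`, so its true label is `!f x`: labels come
for free, and repeating `f` gives an i.i.d. sample of `D` conditioned on that error set. By the
ε-net theorem (`exists_measurableSet_consistent`, proved by double sampling and Sauer's lemma), any
consistent member of `H` errs on at most a fraction `η` of the error set of `f`.

Such a member may be bad elsewhere, and this is repaired by majority votes. A phase reduces the risk
`a` of a function `base`. Its first block finds a member of `H` that is good on the error set `B` of
`base`. Each of the `K` later blocks samples errors of `current`, finds `g ∈ H` consistent with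
these and with the stored errors of `base`, and replaces `current` by the majority of `base`,
`current` and `g`. On `B` the new function errs only where `current` or `g` does, which adds at most
`η * a`. Off `B`, where `base` is right, `current` and `g` must both err, so the error there is at
most `η` times the risk of `current` and shrinks geometrically (`PhaseInvariant.step`). With `η = 1
/ (4 * (K + 2))` and `K = ⌈log₂ (1 / ε)⌉`, a phase divides the risk by 4 up to an additive `ε / 4`,
and `K` phases suffice (`Invariant.step`).

There are `K * (K + 1)` blocks with one function each. Each fails to yield a net with probability at
most `1 / (3 * K * (K + 1))`. If the adversary is not strong for a presented function, the learner
has already won. -/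

namespace AdvLearning

/-! ### Sauer's lemma for error patterns. -/

section Shattering

variable {X : Type u} [MeasurableSpace X]

lemma card_le_of_shatters {H : Set (Classifier X)} {d : ℕ} (hd : vcDim H ≤ d) {S : Finset X}
    (hS : Shatters H S) : S.card ≤ d := by
  have h : (S.card : ℕ∞) ≤ vcDim H := le_iSup₂_of_le S hS le_rfl
  exact_mod_cast h.trans hd

open Classical in
/-- The sets of indices at which a member of `H` errs on the points `z`. -/
noncomputable def errorPatterns {ι : Type*} [Fintype ι] (H : Set (Classifier X)) (h : Classifier X)
    (z : ι → X) : Finset (Finset ι) :=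
  Finset.univ.filter fun J => ∃ g ∈ H, ∀ j, j ∈ J ↔ g.1 (z j) ≠ h.1 (z j)

lemma mem_errorPatterns {ι : Type*} [Fintype ι] {H : Set (Classifier X)} {h : Classifier X}
    {z : ι → X} {J : Finset ι} :
    J ∈ errorPatterns H h z ↔ ∃ g ∈ H, ∀ j, j ∈ J ↔ g.1 (z j) ≠ h.1 (z j) := by
  simp [errorPatterns]

/-- **Sauer's lemma** for the error patterns on a tuple of points. -/
lemma card_errorPatterns_le {ι : Type*} [Fintype ι] {H : Set (Classifier X)} {d : ℕ}
    (hd : vcDim H ≤ d) (h : Classifier X) (z : ι → X) :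
    (errorPatterns H h z).card ≤ ∑ k ∈ Finset.range (d + 1), (Fintype.card ι).choose k := by
  classical
  have hvc : (errorPatterns H h z).vcDim ≤ d := by
    refine Finset.sup_le fun J hJ => ?_
    rw [Finset.mem_shatterer] at hJ
    -- Whether `g` errs at an index depends only on the point there, so no pattern separates two
    -- indices of the same point.
    have hinj : Set.InjOn z J := by
      intro i hi j hj hij
      by_contra hne
      obtain ⟨K, hK, hKJ⟩ := hJ (t := {i}) (by simpa using hi)
      obtain ⟨g, -, hg⟩ := mem_errorPatterns.1 hK
      have h1 : i ∈ K := by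
        have : i ∈ J ∩ K := by rw [hKJ]; simp
        exact (Finset.mem_inter.1 this).2
      have h2 : j ∉ K := fun hjK => by
        have : j ∈ J ∩ K := Finset.mem_inter.2 ⟨hj, hjK⟩
        rw [hKJ] at this
        exact hne (Finset.mem_singleton.1 this).symm
      rw [hg] at h1 h2
      rw [hij] at h1
      exact h2 h1
    rw [← Finset.card_image_of_injOn hinj]
    refine card_le_of_shatters hd fun b => ?_
    -- With two labels, erring exactly where `b` differs from `h` means agreeing with `b`.
    obtain ⟨K, hK, hKJ⟩ := hJ (t := J.filter fun j => b (z j) ≠ h.1 (z j))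
      (Finset.filter_subset _ _)
    obtain ⟨g, hgH, hg⟩ := mem_errorPatterns.1 hK
    refine ⟨g, hgH, fun x hx => ?_⟩
    obtain ⟨j, hj, rfl⟩ := Finset.mem_image.1 hx
    have h1 : j ∈ K ↔ b (z j) ≠ h.1 (z j) := by
      have := congrArg (j ∈ ·) hKJ
      simpa [hj] using this
    rw [hg] at h1
    revert h1
    cases g.1 (z j) <;> cases b (z j) <;> cases h.1 (z j) <;> simp
  calc (errorPatterns H h z).card ≤ _ := Finset.card_le_card_shatterer _
    _ ≤ _ := Finset.card_shatterer_le_sum_vcDim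
    _ ≤ _ := by
      refine Finset.sum_le_sum_of_subset fun k hk => ?_
      simp only [Finset.mem_Iic, Finset.mem_range] at *
      omega

end Shattering

/-! ### Counting random swaps of a double sample. -/

section Swaps

/-- The permutation of `ι ⊕ ι` that exchanges the two copies of `i` whenever `σ i = true`. -/
def swapCopies {ι : Type*} (σ : ι → Bool) : Equiv.Perm (ι ⊕ ι) :=
  Function.Involutive.toPerm
    (Sum.elim (fun i => if σ i then Sum.inr i else Sum.inl i)
      (fun i => if σ i then Sum.inl i else Sum.inr i)) (by
    rintro (i | i) <;> cases h : σ i <;> simp [h])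

lemma swapCopies_inl {ι : Type*} (σ : ι → Bool) (i : ι) :
    swapCopies σ (Sum.inl i) = if σ i then Sum.inr i else Sum.inl i := rfl

lemma swapCopies_inr {ι : Type*} (σ : ι → Bool) (i : ι) :
    swapCopies σ (Sum.inr i) = if σ i then Sum.inl i else Sum.inr i := rfl

open Classical in
/-- Few swaps move all elements of `J` to the second copy if there are at least `r` of them. -/
lemma card_swaps_le {ι : Type*} [Fintype ι] (J : Finset (ι ⊕ ι)) (r : ℕ) :
    (Finset.univ.filter fun σ : ι → Bool => (∀ i, swapCopies σ (Sum.inl i) ∉ J) ∧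
      r ≤ (Finset.univ.filter fun i => swapCopies σ (Sum.inr i) ∈ J).card).card * 2 ^ r ≤
      2 ^ Fintype.card ι := by
  set T := Finset.univ.filter fun σ : ι → Bool => (∀ i, swapCopies σ (Sum.inl i) ∉ J) ∧
      r ≤ (Finset.univ.filter fun i => swapCopies σ (Sum.inr i) ∈ J).card with hT
  rcases T.eq_empty_or_nonempty with h0 | ⟨τ, hτ⟩
  · simp [h0]
  obtain ⟨hτ1, hτ2⟩ := (Finset.mem_filter.1 hτ).2
  set I := Finset.univ.filter fun i => swapCopies τ (Sum.inr i) ∈ J with hI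
  -- At an index in `I`, exactly one of the two copies lies in `J`, and it must end up in the second
  -- half. Hence every good `σ` agrees with `τ` on `I`.
  have hsub : T ⊆ Fintype.piFinset fun i => if i ∈ I then {τ i} else Finset.univ := by
    intro σ hσ
    obtain ⟨hσ1, -⟩ := (Finset.mem_filter.1 hσ).2
    rw [Fintype.mem_piFinset]
    intro i
    by_cases hi : i ∈ I
    · have h1 := (Finset.mem_filter.1 hi).2
      have h2 := hσ1 i
      have h3 := hτ1 i
      rw [swapCopies_inr] at h1
      rw [swapCopies_inl] at h2 h3
      simp only [hi, if_true, Finset.mem_singleton]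
      cases hs : σ i <;> cases ht : τ i <;> simp_all
    · simp [hi]
  have hcard : (Fintype.piFinset fun i => if i ∈ I then {τ i} else Finset.univ).card * 2 ^ I.card =
      2 ^ Fintype.card ι := by
    rw [Fintype.card_piFinset, ← Finset.prod_const, ← Finset.card_univ, ← Finset.prod_const,
      ← Finset.prod_mul_prod_compl I (fun _ : ι => 2),
      ← Finset.prod_mul_prod_compl I (fun i => Finset.card (if i ∈ I then {τ i} else Finset.univ)),
      Finset.prod_congr rfl (g := fun _ => 1) (s₁ := I) (fun i hi => by simp [hi]),
      Finset.prod_congr rfl (g := fun _ => 2) (s₁ := Iᶜ)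
        (fun i hi => by simp [Finset.mem_compl.1 hi])]
    simp [mul_comm]
  calc T.card * 2 ^ r ≤ _ * 2 ^ I.card :=
        Nat.mul_le_mul (Finset.card_le_card hsub) (Nat.pow_le_pow_right (by norm_num) hτ2)
    _ = _ := hcard

end Swaps

/-! ### Product measures and sample measurability. -/

section Product

lemma pi_absolutelyContinuous {X : Type*} [MeasurableSpace X] {μ ν : Measure X}
    [SigmaFinite μ] [SigmaFinite ν] (h : μ ≪ ν) :
    ∀ n : ℕ, Measure.pi (fun _ : Fin n => μ) ≪ Measure.pi (fun _ : Fin n => ν)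
  | 0 => by rw [Measure.pi_of_empty, Measure.pi_of_empty]
  | n + 1 => by
    have h1 := (measurePreserving_piFinSuccAbove (fun _ : Fin (n + 1) => μ) 0).symm
    have h2 := (measurePreserving_piFinSuccAbove (fun _ : Fin (n + 1) => ν) 0).symm
    rw [← h1.map_eq, ← h2.map_eq]
    exact (h.prod (pi_absolutelyContinuous h n)).map (MeasurableEquiv.measurable _)

lemma measurePreserving_comp_equiv {X ι κ : Type*} [MeasurableSpace X] [Fintype ι] [Fintype κ]
    (μ : Measure X) [SigmaFinite μ] (e : ι ≃ κ) :
    MeasurePreserving (fun z : κ → X => z ∘ e) (Measure.pi fun _ => μ) (Measure.pi fun _ => μ) := by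
  have := measurePreserving_piCongrLeft (fun _ : ι => μ) e.symm
  convert this using 1
  ext z i
  have := MeasurableEquiv.piCongrLeft_apply_apply e.symm (β := fun _ => X) z (e i)
  rw [Equiv.symm_apply_apply] at this
  exact this.symm

variable {X : Type u} [MeasurableSpace X]

/-- The samples in the game follow `D` conditioned on an error set, while the hypothesis concerns
`D` itself. -/
lemma SampleMeasurable.absolutelyContinuous {H : Set (Classifier X)} {D P : Measure X}
    [SigmaFinite D] [SigmaFinite P] (hH : SampleMeasurable H D) (h : P ≪ D) :
    SampleMeasurable H P :=
  fun n b => (hH n b).mono_ac (pi_absolutelyContinuous h n)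

lemma SampleMeasurable.nullMeasurableSet {ι : Type*} [Fintype ι] {H : Set (Classifier X)}
    {D : Measure X} [SigmaFinite D] (hH : SampleMeasurable H D) (b : ι → Bool) :
    NullMeasurableSet {x : ι → X | ∃ h ∈ H, ∀ i, h.1 (x i) = b i}
      (Measure.pi fun _ : ι => D) := by
  have e := Fintype.equivFin ι
  have := (hH _ (b ∘ e.symm)).preimage (measurePreserving_comp_equiv D e.symm).quasiMeasurePreserving
  convert this using 1
  ext x
  simp only [Set.mem_ofPred_eq, Set.mem_preimage, Function.comp_apply]
  constructor
  · rintro ⟨h, hh, h1⟩; exact ⟨h, hh, fun i => h1 _⟩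
  · rintro ⟨h, hh, h1⟩; exact ⟨h, hh, fun i => by simpa using h1 (e i)⟩

end Product

/-! ### Double samples: symmetrization and the reverse Markov inequality. -/

section DoubleSample

variable {X : Type u} [MeasurableSpace X] {ι : Type*} [Fintype ι]

lemma measurableSet_errorSet (h f : Classifier X) : MeasurableSet (errorSet h f) :=
  (measurableSet_eq_fun f.2 h.2).compl

open Classical in
/-- The double samples for which a member of `H` is correct on the first half and errs on at least
`r` points of the second half. -/
def doubleSampleBad (ι : Type*) [Fintype ι] (H : Set (Classifier X)) (h : Classifier X) (r : ℕ) :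
    Set (ι ⊕ ι → X) :=
  {z | ∃ g ∈ H, (∀ i, g.1 (z (Sum.inl i)) = h.1 (z (Sum.inl i))) ∧
    r ≤ (Finset.univ.filter fun i => g.1 (z (Sum.inr i)) ≠ h.1 (z (Sum.inr i))).card}

/-- Once the labels `b` of `g` and `c` of `h` are fixed, the condition is purely combinatorial, so
the event is a finite union of sets covered by `SampleMeasurable`. -/
lemma nullMeasurableSet_doubleSampleBad {H : Set (Classifier X)} {P : Measure X} [SigmaFinite P]
    (hH : SampleMeasurable H P) (h : Classifier X) (r : ℕ) :
    NullMeasurableSet (doubleSampleBad ι H h r) (Measure.pi fun _ => P) := by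
  classical
  have : doubleSampleBad ι H h r = ⋃ (b : ι ⊕ ι → Bool) (c : ι ⊕ ι → Bool)
      (_ : (∀ i, b (Sum.inl i) = c (Sum.inl i)) ∧
        r ≤ (Finset.univ.filter fun i => b (Sum.inr i) ≠ c (Sum.inr i)).card),
      {z | ∃ g ∈ H, ∀ j, g.1 (z j) = b j} ∩ {z | ∀ j, h.1 (z j) = c j} := by
    ext z
    simp only [doubleSampleBad, Set.mem_iUnion, Set.mem_inter_iff, Set.mem_ofPred_eq, exists_prop]
    constructor
    · rintro ⟨g, hg, h1, h2⟩
      exact ⟨fun j => g.1 (z j), fun j => h.1 (z j), ⟨h1, h2⟩, ⟨g, hg, fun _ => rfl⟩, fun _ => rfl⟩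
    · rintro ⟨b, c, ⟨h1, h2⟩, ⟨g, hg, h3⟩, h4⟩
      refine ⟨g, hg, ?_, ?_⟩
      · simpa only [h3, h4] using h1
      · simpa only [h3, h4] using h2
  rw [this]
  refine NullMeasurableSet.iUnion fun b => NullMeasurableSet.iUnion fun c =>
    NullMeasurableSet.iUnion fun _ => (hH.nullMeasurableSet b).inter ?_
  have : {z : ι ⊕ ι → X | ∀ j, h.1 (z j) = c j} = ⋂ j, (fun z => h.1 (z j)) ⁻¹' {c j} := by
    ext; simp
  rw [this]
  exact (MeasurableSet.iInter fun j =>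
    (h.2.comp (measurable_pi_apply j)) (measurableSet_singleton _)).nullMeasurableSet

open Classical in
-- Union bound over the error patterns on the fixed points `z`: Sauer's lemma counts the patterns,
-- `card_swaps_le` the swaps for each.
lemma card_swaps_doubleSampleBad_le {H : Set (Classifier X)} {d : ℕ} (hd : vcDim H ≤ d)
    (h : Classifier X) (r : ℕ) (z : ι ⊕ ι → X) :
    (Finset.univ.filter fun σ : ι → Bool => z ∘ swapCopies σ ∈ doubleSampleBad ι H h r).card * 2 ^ r
      ≤ (∑ k ∈ Finset.range (d + 1), (2 * Fintype.card ι).choose k) * 2 ^ Fintype.card ι := by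
  set T := errorPatterns H h z
  have hsub : (Finset.univ.filter fun σ : ι → Bool => z ∘ swapCopies σ ∈ doubleSampleBad ι H h r) ⊆
      T.biUnion fun J => Finset.univ.filter fun σ : ι → Bool =>
        (∀ i, swapCopies σ (Sum.inl i) ∉ J) ∧
        r ≤ (Finset.univ.filter fun i => swapCopies σ (Sum.inr i) ∈ J).card := by
    intro σ hσ
    obtain ⟨g, hg, h1, h2⟩ := (Finset.mem_filter.1 hσ).2
    simp only [Finset.mem_biUnion, Finset.mem_filter, Finset.mem_univ, true_and]
    refine ⟨Finset.univ.filter fun j => g.1 (z j) ≠ h.1 (z j),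
      mem_errorPatterns.2 ⟨g, hg, by simp⟩, ?_, ?_⟩
    · simpa using h1
    · simpa using h2
  calc _ ≤ (∑ J ∈ T, (Finset.univ.filter fun σ : ι → Bool =>
        (∀ i, swapCopies σ (Sum.inl i) ∉ J) ∧
        r ≤ (Finset.univ.filter fun i => swapCopies σ (Sum.inr i) ∈ J).card).card) * 2 ^ r :=
        Nat.mul_le_mul_right _ ((Finset.card_le_card hsub).trans Finset.card_biUnion_le)
    _ ≤ ∑ _J ∈ T, 2 ^ Fintype.card ι := by
        rw [Finset.sum_mul]
        exact Finset.sum_le_sum fun J _ => card_swaps_le J r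
    _ = T.card * 2 ^ Fintype.card ι := by simp
    _ ≤ _ := by
        refine Nat.mul_le_mul_right _ ((card_errorPatterns_le hd h z).trans_eq ?_)
        simp [two_mul]

/-- Swaps preserve the product measure, so the probability can be averaged over all swaps and
bounded pointwise in `z`. -/
lemma measure_doubleSampleBad_le {H : Set (Classifier X)} {d : ℕ} (hd : vcDim H ≤ d)
    {P : Measure X} [IsProbabilityMeasure P] (hH : SampleMeasurable H P) (h : Classifier X)
    (r : ℕ) :
    (Measure.pi fun _ : ι ⊕ ι => P) (doubleSampleBad ι H h r) * 2 ^ r ≤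
      (∑ k ∈ Finset.range (d + 1), (2 * Fintype.card ι).choose k : ℕ) := by
  classical
  set μ := Measure.pi fun _ : ι ⊕ ι => P
  set B := doubleSampleBad ι H h r
  have hB : NullMeasurableSet B μ := nullMeasurableSet_doubleSampleBad hH h r
  have hpre : ∀ σ : ι → Bool, NullMeasurableSet ((fun z : ι ⊕ ι → X => z ∘ swapCopies σ) ⁻¹' B) μ ∧
      μ ((fun z : ι ⊕ ι → X => z ∘ swapCopies σ) ⁻¹' B) = μ B := fun σ =>
    have hp := measurePreserving_comp_equiv P (swapCopies σ)
    ⟨hB.preimage hp.quasiMeasurePreserving, hp.measure_preimage hB⟩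
  set S := ∑ k ∈ Finset.range (d + 1), (2 * Fintype.card ι).choose k
  have key : (2 : ℝ≥0∞) ^ Fintype.card ι * (μ B * 2 ^ r) ≤ 2 ^ Fintype.card ι * S := by
    calc (2 : ℝ≥0∞) ^ Fintype.card ι * (μ B * 2 ^ r)
        = (∑ _σ : ι → Bool, μ B) * 2 ^ r := by simp [mul_assoc]
      _ = (∑ σ : ι → Bool, ∫⁻ z, ((fun z : ι ⊕ ι → X => z ∘ swapCopies σ) ⁻¹' B).indicator 1 z ∂μ)
            * 2 ^ r := by
          congr 1
          refine Finset.sum_congr rfl fun σ _ => ?_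
          rw [lintegral_indicator_one₀ (hpre σ).1, (hpre σ).2]
      _ = ∫⁻ z, (∑ σ : ι → Bool,
            ((fun z : ι ⊕ ι → X => z ∘ swapCopies σ) ⁻¹' B).indicator 1 z) * 2 ^ r ∂μ := by
          rw [lintegral_mul_const' _ _ (by finiteness), lintegral_finsetSum']
          exact fun σ _ => (aemeasurable_indicator_const_iff (1 : ℝ≥0∞)).2 (hpre σ).1
      _ ≤ ∫⁻ _, 2 ^ Fintype.card ι * S ∂μ := by
          refine lintegral_mono fun z => ?_
          have := card_swaps_doubleSampleBad_le hd h r z (ι := ι)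
          simp only [Set.indicator_apply, Set.mem_preimage, Pi.one_apply, Finset.sum_boole]
          rw [mul_comm (2 ^ _)]
          exact_mod_cast this
      _ = _ := by simp
  exact (ENNReal.mul_le_mul_iff_right (by simp) (by finiteness)).1 key

/-- The reverse Markov inequality for the number of points of a sample that lie in `E`. -/
lemma le_measure_card_mem {P : Measure X} [IsProbabilityMeasure P] {E : Set X}
    [DecidablePred (· ∈ E)] (hE : MeasurableSet E) {Q r : ℕ} (hr : 0 < r) (hQ : 0 < Q)
    (hP : (Q : ℝ≥0∞)⁻¹ ≤ P E) (hι : Fintype.card ι = 2 * Q * r) :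
    ((2 * Q : ℕ) : ℝ≥0∞)⁻¹ ≤ (Measure.pi fun _ : ι => P)
      {y | r ≤ (Finset.univ.filter fun i => y i ∈ E).card} := by
  classical
  set μ := Measure.pi fun _ : ι => P
  set F := {y : ι → X | r ≤ (Finset.univ.filter fun i => y i ∈ E).card}
  have hev : ∀ i, MeasurableSet {y : ι → X | y i ∈ E} := fun i => measurable_pi_apply i hE
  have hcast : ∀ y : ι → X, ((Finset.univ.filter fun i => y i ∈ E).card : ℝ≥0∞) =
      ∑ i, {y : ι → X | y i ∈ E}.indicator 1 y := fun y => by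
    simp [Set.indicator_apply]
  have hmeas : Measurable fun y : ι → X => ((Finset.univ.filter fun i => y i ∈ E).card : ℝ≥0∞) := by
    simp_rw [hcast]
    exact Finset.measurable_sum _ fun i _ => measurable_one.indicator (hev i)
  have hF : MeasurableSet F := by
    have : F = {y | (r : ℝ≥0∞) ≤ ((Finset.univ.filter fun i => y i ∈ E).card : ℝ≥0∞)} := by
      ext y; simp [F]
    rw [this]
    exact measurableSet_le measurable_const hmeas
  have hint : ∫⁻ y, ((Finset.univ.filter fun i => y i ∈ E).card : ℝ≥0∞) ∂μ =
      (2 * Q * r : ℕ) * P E := by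
    simp_rw [hcast]
    rw [lintegral_finsetSum _ fun i _ => measurable_one.indicator (hev i)]
    have : ∀ i, ∫⁻ y, {y : ι → X | y i ∈ E}.indicator 1 y ∂μ = P E := fun i => by
      rw [lintegral_indicator_one (hev i)]
      exact (measurePreserving_eval (fun _ : ι => P) i).measure_preimage hE.nullMeasurableSet
    simp [this, hι]
  -- The count is at most `r` off `F` and at most the sample size `2 * Q * r` on `F`, while its mean
  -- is at least `2 * r`.
  have hle : ∫⁻ y, ((Finset.univ.filter fun i => y i ∈ E).card : ℝ≥0∞) ∂μ ≤
      r + (2 * Q * r : ℕ) * μ F := by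
    calc _ ≤ ∫⁻ y, ((r : ℝ≥0∞) + F.indicator (fun _ => ((2 * Q * r : ℕ) : ℝ≥0∞)) y) ∂μ := by
          refine lintegral_mono fun y => ?_
          by_cases hy : y ∈ F
          · rw [Set.indicator_of_mem hy]
            refine le_add_left ?_
            rw [← hι]
            exact_mod_cast (Finset.card_filter_le _ _)
          · have : (Finset.univ.filter fun i => y i ∈ E).card ≤ r := by
              simp only [F, Set.mem_ofPred_eq] at hy; omega
            refine le_add_right ?_
            exact_mod_cast this
      _ = _ := by
          rw [lintegral_add_left measurable_const, lintegral_indicator_const hF]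
          simp
  rw [hint] at hle
  have hreal : (2 * Q * r : ℝ) * (P E).toReal ≤ r + 2 * Q * r * (μ F).toReal := by
    have := ENNReal.toReal_mono (by finiteness) hle
    rw [ENNReal.toReal_add (by finiteness) (by finiteness)] at this
    simpa using this
  have hPr : (Q : ℝ)⁻¹ ≤ (P E).toReal := by
    have := ENNReal.toReal_mono (by finiteness) hP
    simpa using this
  have hQ' : (0 : ℝ) < Q := by exact_mod_cast hQ
  have hr' : (0 : ℝ) < r := by exact_mod_cast hr
  have h1 : (2 * Q * r : ℝ) * (Q : ℝ)⁻¹ ≤ 2 * Q * r * (P E).toReal := by gcongr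
  have h2 : (2 * Q * r : ℝ) * (Q : ℝ)⁻¹ = 2 * r := by field_simp
  have h3 : (1 : ℝ) ≤ (2 * Q) * (μ F).toReal := by
    have : (r : ℝ) * 1 ≤ r * ((2 * Q) * (μ F).toReal) := by linarith
    exact le_of_mul_le_mul_left this hr'
  rw [← ENNReal.toReal_le_toReal (by simp; omega) (by finiteness)]
  rw [ENNReal.toReal_inv, inv_le_iff_one_le_mul₀ (by simp; omega)]
  simpa [mul_comm] using h3

end DoubleSample

/-! ### The ε-net theorem. -/

section Consistent

variable {X : Type u} [MeasurableSpace X]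

/-- The **ε-net theorem** with `ε = 1 / Q`: on all samples of size `2 * Q * r` outside a set of small
measure, a member of `H` that is correct on the sample has error at most `1 / Q`. -/
lemma exists_measurableSet_consistent {H : Set (Classifier X)} {d : ℕ} (hd : vcDim H ≤ d)
    {P : Measure X} [IsProbabilityMeasure P] (hH : SampleMeasurable H P) (h : Classifier X)
    {Q r m : ℕ} (hQ : 0 < Q) (hr : 0 < r) (hm : m = 2 * Q * r) :
    ∃ G : Set (Fin m → X), MeasurableSet G ∧
      (Measure.pi fun _ : Fin m => P) Gᶜ * 2 ^ r ≤
        (2 * Q * ∑ k ∈ Finset.range (d + 1), (2 * m).choose k : ℕ) ∧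
      ∀ x ∈ G, ∀ g ∈ H, (∀ i, g.1 (x i) = h.1 (x i)) → P (errorSet h g) ≤ (Q : ℝ≥0∞)⁻¹ := by
  classical
  set μ := Measure.pi fun _ : Fin m => P
  set S := ∑ k ∈ Finset.range (d + 1), (2 * m).choose k
  set B := doubleSampleBad (Fin m) H h r
  set ν := Measure.pi fun _ : Fin m ⊕ Fin m => P
  have hB : ν B * 2 ^ r ≤ S := by
    have := measure_doubleSampleBad_le (ι := Fin m) hd hH h r
    rwa [Fintype.card_fin] at this
  have hpres := measurePreserving_sumPiEquivProdPi_symm fun _ : Fin m ⊕ Fin m => P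
  set φ := (MeasurableEquiv.sumPiEquivProdPi fun _ : Fin m ⊕ Fin m => X).symm
  -- The bad event is only null-measurable; its measurable hull has the same measure and measurable
  -- sections.
  set B' := φ ⁻¹' toMeasurable ν B
  have hB' : MeasurableSet B' := φ.measurable (measurableSet_toMeasurable _ _)
  have hνB : (μ.prod μ) B' = ν B := by
    rw [hpres.measure_preimage (measurableSet_toMeasurable _ _).nullMeasurableSet,
      measure_toMeasurable]
  have hφ := measurable_measure_prodMk_left (ν := μ) hB'
  have hmarkov : μ {x | ((2 * Q : ℕ) : ℝ≥0∞)⁻¹ ≤ μ (Prod.mk x ⁻¹' B')} ≤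
      ν B / ((2 * Q : ℕ) : ℝ≥0∞)⁻¹ := by
    rw [← hνB, Measure.prod_apply hB']
    exact meas_ge_le_lintegral_div hφ.aemeasurable (ENNReal.inv_ne_zero.2 (ENNReal.natCast_ne_top _))
      (ENNReal.inv_ne_top.2 (by exact_mod_cast (by omega : 2 * Q ≠ 0)))
  refine ⟨{x | ((2 * Q : ℕ) : ℝ≥0∞)⁻¹ ≤ μ (Prod.mk x ⁻¹' B')}ᶜ,
    (measurableSet_le measurable_const hφ).compl, ?_, ?_⟩
  · rw [compl_compl]
    calc _ ≤ ν B / ((2 * Q : ℕ) : ℝ≥0∞)⁻¹ * 2 ^ r := by gcongr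
      _ = ((2 * Q : ℕ) : ℝ≥0∞) * (ν B * 2 ^ r) := by
        rw [div_eq_mul_inv, inv_inv]; ring
      _ ≤ ((2 * Q : ℕ) : ℝ≥0∞) * S := by gcongr
      _ = _ := by push_cast; rfl
  -- A consistent `g` with larger error would be caught by a fresh second half with probability at
  -- least `1 / (2 * Q)`, placing `x` in the excluded set.
  · intro x hx g hg hgx
    by_contra! hlt
    refine hx ((le_measure_card_mem (ι := Fin m) (measurableSet_errorSet h g) hr hQ hlt.le
      (by simpa using hm)).trans (measure_mono fun y hy => ?_))
    refine subset_toMeasurable ν B ⟨g, hg, ?_, ?_⟩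
    · exact hgx
    · exact hy.trans (le_of_eq (by congr))

end Consistent

/-! ### Strong adversaries and blocks of repeated queries. -/

section Game

variable {X : Type u} [MeasurableSpace X]

lemma Adversary.isProbabilityMeasure_attack (A : Adversary X) (D : Measure X)
    [IsProbabilityMeasure D] (f : Classifier X) : IsProbabilityMeasure (A.attack D f) := by
  have := A.markov f
  unfold Adversary.attack
  infer_instance

/-- Against an adversary that is strong for `f`, the risk of `f` is positive and the answers have
the law `D` conditioned on the error set of `f`. -/
lemma Adversary.IsStrong.attack_eq {A : Adversary X} {D : Measure X} [IsProbabilityMeasure D]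
    {h f : Classifier X} (hA : A.IsStrong D h f) :
    D (errorSet h f) ≠ 0 ∧ A.attack D f = D[|errorSet h f] := by
  have := A.isProbabilityMeasure_attack D f
  unfold Adversary.IsStrong EQ at hA
  split_ifs at hA with h0
  · exfalso
    -- An adversary can never answer "YES": its law gives the copy of `X` mass 1, whereas "YES"
    -- gives it mass 0.
    have h1 := congrArg (fun μ => μ (Set.range Sum.inl)) hA
    simp only [Measure.map_apply measurable_inl measurableSet_range_inl,
      Measure.dirac_apply' _ measurableSet_range_inl] at h1
    simp at h1
  · refine ⟨fun h1 => h0 (by simp [risk, Measure.real, h1]), ?_⟩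
    have hinl : MeasurableEmbedding (Sum.inl : X → X ⊕ Unit) :=
      ⟨Sum.inl_injective, measurable_inl, fun _ hs => measurableSet_inl_image.2 hs⟩
    have h1 := congrArg (Measure.comap Sum.inl) hA
    rwa [hinl.comap_map, hinl.comap_map] at h1

/-- Used once a presented function has exposed the adversary as not strong: success is then certain,
whatever follows. -/
lemma gameProbFrom_eq_one (L : Learner X) (A : Adversary X) (D : Measure X)
    [IsProbabilityMeasure D] (E : List X → Prop) :
    ∀ (n : ℕ) (w : List X), (∀ v : List X, v.length = n → E (w ++ v)) →
      gameProbFrom L A D E n w = 1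
  | 0, w, h => by
    have : E w := by simpa using h [] rfl
    simp [gameProbFrom, this]
  | n + 1, w, h => by
    have := A.isProbabilityMeasure_attack D (L.query w)
    have h1 : ∀ x, gameProbFrom L A D E n (w ++ [x]) = 1 := fun x =>
      gameProbFrom_eq_one L A D E n (w ++ [x]) fun v hv => by
        simpa using h (x :: v) (by simp [hv])
    simp [gameProbFrom, h1]

/-- If the same function is presented for `m` rounds, its answers are an i.i.d. sample. -/
lemma lintegral_le_gameProbFrom (L : Learner X) (A : Adversary X) (D : Measure X)
    [IsProbabilityMeasure D] (E : List X → Prop) (f : Classifier X) (n : ℕ) :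
    ∀ (m : ℕ) (w : List X), (∀ v : List X, v.length < m → L.query (w ++ v) = f) →
      -- The success probability need not be measurable in the history, hence a measurable minorant
      -- `F`.
      ∀ F : (Fin m → X) → ℝ≥0∞, Measurable F →
        (∀ x, F x ≤ gameProbFrom L A D E n (w ++ List.ofFn x)) →
        ∫⁻ x, F x ∂(Measure.pi fun _ => A.attack D f) ≤ gameProbFrom L A D E (m + n) w
  | 0, w, _, F, hFm, hF => by
    rw [Measure.pi_of_empty, lintegral_dirac' _ hFm]
    simpa using hF isEmptyElim
  | m + 1, w, hq, F, hFm, hF => by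
    have := A.isProbabilityMeasure_attack D f
    rw [Nat.add_right_comm, gameProbFrom]
    have hw : L.query w = f := by simpa using hq [] (by simp)
    rw [hw]
    have hp := (measurePreserving_piFinSuccAbove (fun _ : Fin (m + 1) => A.attack D f) 0).symm
    have hFc : Measurable fun z => F ((MeasurableEquiv.piFinSuccAbove (fun _ => X) 0).symm z) :=
      hFm.comp hp.measurable
    rw [← hp.lintegral_comp hFm, lintegral_prod _ hFc.aemeasurable]
    refine lintegral_mono fun y => ?_
    refine lintegral_le_gameProbFrom L A D E f n m (w ++ [y]) ?_
      (fun x => F ((MeasurableEquiv.piFinSuccAbove (fun _ => X) 0).symm (y, x)))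
      (hFc.comp measurable_prodMk_left) fun x => ?_
    · intro v hv
      simpa using hq (y :: v) (by simp; omega)
    · refine (hF _).trans (le_of_eq ?_)
      simp [List.ofFn_succ, MeasurableEquiv.piFinSuccAbove, Fin.insertNthEquiv]

end Game

/-! ### Numerical estimates for the sample size. -/

section Numbers

/-- Weight the terms of `(1 + 1 / c) ^ (c * d) ≤ exp d` by `c⁻¹ ^ k ≥ c⁻¹ ^ d`, and use `exp 1 ≤ 3`.
-/
lemma sum_choose_le {c d : ℕ} (hc : 0 < c) (hd : 0 < d) :
    ∑ k ∈ Finset.range (d + 1), (c * d).choose k ≤ (3 * c) ^ d := by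
  have hc' : (1 : ℝ) ≤ c := by exact_mod_cast hc
  have hd' : (1 : ℝ) ≤ d := by exact_mod_cast hd
  have hx1 : (c : ℝ)⁻¹ ≤ 1 := inv_le_one_of_one_le₀ hc'
  have hx0 : 0 < (c : ℝ)⁻¹ := by positivity
  have h1 : ((c : ℝ)⁻¹) ^ d * (∑ k ∈ Finset.range (d + 1), (c * d).choose k : ℕ) ≤
      (1 + (c : ℝ)⁻¹) ^ (c * d) := by
    rw [add_comm (1 : ℝ), add_pow, Nat.cast_sum, Finset.mul_sum]
    simp only [one_pow, mul_one]
    calc _ ≤ ∑ k ∈ Finset.range (d + 1), ((c : ℝ)⁻¹) ^ k * (c * d).choose k := by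
          refine Finset.sum_le_sum fun k hk => ?_
          have hk' : k ≤ d := by simpa [Nat.lt_succ_iff] using hk
          refine mul_le_mul_of_nonneg_right ?_ (Nat.cast_nonneg _)
          exact pow_le_pow_of_le_one hx0.le hx1 hk'
      _ ≤ _ := by
          refine Finset.sum_le_sum_of_subset_of_nonneg ?_ fun k _ _ => by positivity
          intro k
          simp only [Finset.mem_range]
          have : d ≤ c * d := Nat.le_mul_of_pos_left d hc
          omega
  have h2 : (1 + (c : ℝ)⁻¹) ^ (c * d) ≤ 3 ^ d := by
    rw [pow_mul]
    gcongr
    calc (1 + (c : ℝ)⁻¹) ^ c ≤ (Real.exp (c : ℝ)⁻¹) ^ c := by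
          gcongr
          rw [add_comm]
          exact Real.add_one_le_exp _
      _ = Real.exp 1 := by
          rw [← Real.exp_nat_mul, mul_inv_cancel₀ (by positivity)]
      _ ≤ 3 := by linarith [Real.exp_one_lt_d9]
  have h3 := h1.trans h2
  have h4 : ((∑ k ∈ Finset.range (d + 1), (c * d).choose k : ℕ) : ℝ) ≤ (3 * c) ^ d := by
    rw [inv_pow, inv_mul_le_iff₀ (by positivity)] at h3
    rwa [mul_pow, mul_comm ((3 : ℝ) ^ d)]
  exact_mod_cast h4

/-- With `Q = 4 * (K + 2)` and `r = 10 * K * d`, this makes the failure probability of a block at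
most `1 / (3 * K * (K + 1))`. The polynomial factors in `K` are absorbed through `K + 2 ≤ 2 ^ K`. -/
lemma sampleSize_bound {K d : ℕ} (hK : 5 ≤ K) (hd : 0 < d) :
    3 * (K * (K + 1)) * (2 * (4 * (K + 2)) *
      ∑ k ∈ Finset.range (d + 1), (2 * (2 * (4 * (K + 2)) * (10 * K * d))).choose k) ≤
      2 ^ (10 * K * d) := by
  have h1 := sum_choose_le (c := 160 * (K + 2) * K) (d := d) (by positivity) hd
  have e1 : 2 * (2 * (4 * (K + 2)) * (10 * K * d)) = 160 * (K + 2) * K * d := by ring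
  rw [e1]
  have hp0 : K ≤ 2 ^ K := Nat.lt_two_pow_self.le
  have hp1 : K + 1 ≤ 2 ^ K := Nat.lt_two_pow_self
  have hp2 : K + 2 ≤ 2 ^ K := by
    obtain ⟨n, rfl⟩ : ∃ n, K = n + 1 := ⟨K - 1, by omega⟩
    have := Nat.lt_two_pow_self (n := n)
    rw [pow_succ]; omega
  calc _ ≤ 3 * (K * (K + 1)) * (2 * (4 * (K + 2)) * (3 * (160 * (K + 2) * K)) ^ d) := by gcongr
    _ = 24 * (K * (K + 1) * (K + 2)) * (480 * ((K + 2) * K)) ^ d := by ring_nf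
    _ ≤ (24 * (K * (K + 1) * (K + 2))) ^ d * (480 * ((K + 2) * K)) ^ d := by
        gcongr
        exact Nat.le_self_pow hd.ne' _
    _ = (11520 * (K * (K + 1) * (K + 2) * (K + 2) * K)) ^ d := by rw [← mul_pow]; ring
    _ ≤ (2 ^ 14 * (2 ^ K * 2 ^ K * 2 ^ K * 2 ^ K * 2 ^ K)) ^ d := by gcongr; norm_num
    _ = 2 ^ ((14 + 5 * K) * d) := by rw [pow_mul]; congr 1; ring
    _ ≤ _ := by gcongr; norm_num; omega

end Numbers

/-! ### The majority-vote algorithm and its invariants. -/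

section Algorithm

variable {X : Type u} [MeasurableSpace X]

variable (X) in
/-- The classifier that is constantly `false`. -/
def falseClassifier : Classifier X := ⟨fun _ => false, measurable_const⟩

open Classical in
/-- Empirical risk minimization: a member of `H` that is consistent with the labelled sample `S`. -/
noncomputable def erm (H : Set (Classifier X)) (S : List (X × Bool)) : Classifier X :=
  if hS : ∃ g ∈ H, ∀ p ∈ S, g.1 p.1 = p.2 then hS.choose else falseClassifier X

lemma erm_spec {H : Set (Classifier X)} {S : List (X × Bool)} {h : Classifier X} (hH : h ∈ H)
    (hS : ∀ p ∈ S, h.1 p.1 = p.2) : erm H S ∈ H ∧ ∀ p ∈ S, (erm H S).1 p.1 = p.2 := by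
  have hS' : ∃ g ∈ H, ∀ p ∈ S, g.1 p.1 = p.2 := ⟨h, hH, hS⟩
  rw [erm, dif_pos hS']
  exact hS'.choose_spec

/-- The majority vote of three classifiers. -/
def majority (f g k : Classifier X) : Classifier X :=
  ⟨fun x => if f.1 x = g.1 x then f.1 x else k.1 x,
    Measurable.ite (measurableSet_eq_fun f.2 g.2) f.2 k.2⟩

lemma errorSet_inter_majority_subset (h f g k : Classifier X) :
    errorSet h f ∩ errorSet h (majority f g k) ⊆
      errorSet h f ∩ errorSet h g ∪ errorSet h f ∩ errorSet h k := by
  rintro x ⟨h1, h2⟩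
  simp only [errorSet, majority, Set.mem_ofPred_eq, Set.mem_union, Set.mem_inter_iff] at *
  split_ifs at h2 with h3
  · exact Or.inl ⟨h1, h3 ▸ h1⟩
  · exact Or.inr ⟨h1, h2⟩

lemma errorSet_majority_diff_subset (h f g k : Classifier X) :
    errorSet h (majority f g k) \ errorSet h f ⊆ errorSet h g ∩ errorSet h k := by
  rintro x ⟨h1, h2⟩
  simp only [errorSet, majority, Set.mem_ofPred_eq, Set.mem_inter_iff, not_not] at *
  split_ifs at h1 with h3
  · exact absurd h2 h1
  · exact ⟨fun h4 => h3 (h2.trans h4.symm), h1⟩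

/-- The counterexamples `xs` to `g` with their labels. -/
def counterexamples (g : Classifier X) (xs : List X) : List (X × Bool) :=
  xs.map fun x => (x, !g.1 x)

/-- The labelled sample `S` is correct, and every member of `H` that is consistent with it is
correct on all but a fraction `η` of the error set of `f`. -/
structure IsErrorNet (D : Measure X) (H : Set (Classifier X)) (h : Classifier X) (η : ℝ)
    (f : Classifier X) (S : List (X × Bool)) : Prop where
  correct : ∀ p ∈ S, h.1 p.1 = p.2
  le : ∀ g ∈ H, (∀ p ∈ S, g.1 p.1 = p.2) →
    D.real (errorSet h f ∩ errorSet h g) ≤ η * D.real (errorSet h f)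

variable (X) in
/-- The memory of the learner: the classifier `base` whose error is to be reduced, the classifier
`current` that is presented, and labelled counterexamples to `base`. -/
structure State where
  base : Classifier X
  current : Classifier X
  sample : List (X × Bool)

open Classical in
/-- The update after the block number `t` of answers. -/
noncomputable def step (H : Set (Classifier X)) (K t : ℕ) (s : State X) (xs : List X) : State X :=
  if t % (K + 1) = 0 then
    ⟨s.current, erm H (counterexamples s.current xs), counterexamples s.current xs⟩
  else
    ⟨s.base,
      majority s.base s.current (erm H (s.sample ++ counterexamples s.current xs)), s.sample⟩

/-- The state after `t` blocks of `m` answers. -/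
noncomputable def stateAt (H : Set (Classifier X)) (K m : ℕ) : ℕ → List X → State X
  | 0, _ => ⟨falseClassifier X, falseClassifier X, []⟩
  | t + 1, w => step H K t (stateAt H K m t w) ((w.drop (t * m)).take m)

/-- The state is determined by completed blocks, so the presented function stays constant within a
block. -/
lemma stateAt_congr (H : Set (Classifier X)) (K m : ℕ) :
    ∀ (t : ℕ) {w v : List X}, w.take (t * m) = v.take (t * m) →
      stateAt H K m t w = stateAt H K m t v
  | 0, _, _, _ => rfl
  | t + 1, w, v, h => by
    have h1 : w.take (t * m) = v.take (t * m) := by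
      have := congrArg (List.take (t * m)) h
      rwa [List.take_take, List.take_take, min_eq_left (Nat.mul_le_mul_right m (Nat.le_succ t))]
        at this
    have h2 : (w.drop (t * m)).take m = (v.drop (t * m)).take m := by
      rw [List.take_drop, List.take_drop, ← Nat.succ_mul, h]
    rw [stateAt, stateAt, stateAt_congr H K m t h1, h2]

variable {D : Measure X} [IsProbabilityMeasure D] {H : Set (Classifier X)} {h : Classifier X}

/-- What holds after the first block and `j` further blocks of a phase: on the error set of `base`,
`current` has become good, and its error elsewhere decreases geometrically. -/
structure PhaseInvariant (D : Measure X) (H : Set (Classifier X)) (h : Classifier X) (η a : ℝ)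
    (j : ℕ) (s : State X) : Prop where
  base_le : D.real (errorSet h s.base) ≤ a
  net : IsErrorNet D H h η s.base s.sample
  inter_le : D.real (errorSet h s.base ∩ errorSet h s.current) ≤ (j + 1) * η * a
  diff_le : D.real (errorSet h s.current \ errorSet h s.base) ≤ η ^ j + η * a

lemma phaseInvariant_start (hH : h ∈ H) {η a : ℝ} (hη : 0 ≤ η) {K t : ℕ} (ht : t % (K + 1) = 0)
    {s : State X} {xs : List X} (hs : D.real (errorSet h s.current) ≤ a)
    (hxs : IsErrorNet D H h η s.current (counterexamples s.current xs)) :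
    PhaseInvariant D H h η a 0 (step H K t s xs) := by
  obtain ⟨h1, h2⟩ := erm_spec hH hxs.correct
  have ha : 0 ≤ a := measureReal_nonneg.trans hs
  rw [step, if_pos ht]
  refine ⟨hs, hxs, ?_, ?_⟩
  · refine (hxs.le _ h1 h2).trans ?_
    simp only [CharP.cast_eq_zero, zero_add, one_mul]
    gcongr
  · refine measureReal_le_one.trans ?_
    simp only [pow_zero, le_add_iff_nonneg_right]
    positivity

lemma PhaseInvariant.step (hH : h ∈ H) {η a : ℝ} (hη : 0 ≤ η) {K t j : ℕ}
    (ht : t % (K + 1) ≠ 0) (hj : (j + 2) * η ≤ 1) {s : State X} {xs : List X}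
    (hs : PhaseInvariant D H h η a j s)
    (hxs : IsErrorNet D H h η s.current (counterexamples s.current xs)) :
    PhaseInvariant D H h η a (j + 1) (step H K t s xs) := by
  obtain ⟨h1, h2⟩ := erm_spec hH (S := s.sample ++ counterexamples s.current xs) (by
    intro p hp
    rcases List.mem_append.1 hp with hp | hp
    · exact hs.net.correct p hp
    · exact hxs.correct p hp)
  have ha : 0 ≤ a := measureReal_nonneg.trans hs.base_le
  have h3 := hs.net.le _ h1 fun p hp => h2 p (List.mem_append_left _ hp)
  have h4 := hxs.le _ h1 fun p hp => h2 p (List.mem_append_right _ hp)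
  rw [AdvLearning.step, if_neg ht]
  have h5 : η * D.real (errorSet h s.base) ≤ η * a := by gcongr; exact hs.base_le
  have h6 : D.real (errorSet h s.current) ≤ (j + 1) * η * a + (η ^ j + η * a) := by
    have := measureReal_inter_add_sdiff (μ := D) (s := errorSet h s.current)
      (measurableSet_errorSet h s.base)
    rw [Set.inter_comm] at this
    linarith [hs.inter_le, hs.diff_le]
  refine ⟨hs.base_le, hs.net, ?_, ?_⟩
  · refine (measureReal_mono (errorSet_inter_majority_subset _ _ _ _)).trans
      ((measureReal_union_le _ _).trans ?_)
    push_cast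
    linarith [hs.inter_le]
  · refine (measureReal_mono (errorSet_majority_diff_subset _ _ _ _)).trans (h4.trans ?_)
    have h7 := mul_le_mul_of_nonneg_left h6 hη
    -- The terms of `h7` other than `η ^ (j + 1)` total `(j + 2) * η * (η * a)`, and `hj` reduces
    -- this to `η * a`.
    have h8 := mul_le_mul_of_nonneg_right hj (mul_nonneg hη ha)
    rw [pow_succ]
    linarith

lemma PhaseInvariant.current_le {η a : ℝ} {j : ℕ} {s : State X}
    (hs : PhaseInvariant D H h η a j s) :
    D.real (errorSet h s.current) ≤ (j + 2) * η * a + η ^ j := by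
  have := measureReal_inter_add_sdiff (μ := D) (s := errorSet h s.current)
    (measurableSet_errorSet h s.base)
  rw [Set.inter_comm] at this
  linarith [hs.inter_le, hs.diff_le]

/-- The bound on the risk after `i` phases. -/
noncomputable def phaseBound (ε : ℝ) (i : ℕ) : ℝ := (1 / 4) ^ i + ε / 2

/-- What holds after `t` blocks. -/
def Invariant (D : Measure X) (H : Set (Classifier X)) (h : Classifier X) (ε : ℝ) (K t : ℕ)
    (s : State X) : Prop :=
  ∃ i, (t = i * (K + 1) ∧ D.real (errorSet h s.current) ≤ phaseBound ε i) ∨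
    ∃ j < K, t = i * (K + 1) + (j + 1) ∧
      PhaseInvariant D H h (1 / (4 * (K + 2))) (phaseBound ε i) j s

lemma Invariant.step (hH : h ∈ H) {ε : ℝ} (hε : 0 ≤ ε) {K t : ℕ} (hK : 0 < K)
    (hKε : (1 / 4 : ℝ) ^ K ≤ ε / 4) {s : State X} {xs : List X} (hs : Invariant D H h ε K t s)
    (hxs : IsErrorNet D H h (1 / (4 * (K + 2))) s.current (counterexamples s.current xs)) :
    Invariant D H h ε K (t + 1) (step H K t s xs) := by
  have hη : (0 : ℝ) ≤ 1 / (4 * (K + 2)) := by positivity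
  obtain ⟨i, ⟨rfl, h1⟩ | ⟨j, hj, rfl, h1⟩⟩ := hs
  · exact ⟨i, Or.inr ⟨0, hK, rfl, phaseInvariant_start hH hη (Nat.mul_mod_left _ _) h1 hxs⟩⟩
  · have hmod : (i * (K + 1) + (j + 1)) % (K + 1) ≠ 0 := by
      rw [Nat.mul_add_mod_self_right, Nat.mod_eq_of_lt (by omega)]
      omega
    have hjK : (j : ℝ) + 1 ≤ K := by exact_mod_cast hj
    have h2 := h1.step hH hη hmod (by
      rw [mul_one_div, div_le_one (by positivity)]; linarith) hxs
    by_cases hj' : j + 1 < K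
    · exact ⟨i, Or.inr ⟨j + 1, hj', by ring, h2⟩⟩
    -- The phase ends here: the next bound `a / 4 + ε / 4` fits since `ε / 8 + ε / 4 ≤ ε / 2`.
    · obtain rfl : K = j + 1 := by omega
      refine ⟨i + 1, Or.inl ⟨by ring, h2.current_le.trans ?_⟩⟩
      have e1 : (((j + 1 : ℕ) : ℝ) + 2) * (1 / (4 * (((j + 1 : ℕ) : ℝ) + 2))) = 1 / 4 := by
        field_simp
      have e2 : (1 / (4 * (((j + 1 : ℕ) : ℝ) + 2))) ^ (j + 1) ≤ (1 / 4 : ℝ) ^ (j + 1) := by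
        gcongr
        push_cast
        linarith
      rw [e1]
      unfold phaseBound
      rw [pow_succ (1 / 4 : ℝ) i]
      linarith

lemma Invariant.risk_le {D : Measure X} {ε : ℝ} {K : ℕ} (hKε : (1 / 4 : ℝ) ^ K ≤ ε / 4) (hε : 0 ≤ ε)
    {s : State X} (hs : Invariant D H h ε K (K * (K + 1)) s) : risk D h s.current ≤ ε := by
  obtain ⟨i, ⟨h1, h2⟩ | ⟨j, hj, h1, -⟩⟩ := hs
  · obtain rfl : K = i := Nat.eq_of_mul_eq_mul_right (Nat.succ_pos K) h1
    refine h2.trans ?_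
    unfold phaseBound
    linarith
  · have h3 := congrArg (· % (K + 1)) h1
    simp only [Nat.mul_mod_left, Nat.mul_add_mod_self_right] at h3
    rw [Nat.mod_eq_of_lt (by omega)] at h3
    omega

end Algorithm

/-! ### The block learner and its success probability. -/

section Learner

variable {X : Type u} [MeasurableSpace X]

/-- The learner that plays `K * (K + 1)` blocks of `m` rounds. -/
noncomputable def blockLearner (H : Set (Classifier X)) (K m : ℕ) : Learner X where
  rounds := K * (K + 1) * m
  query w := (stateAt H K m (w.length / m) w).current
  output w := (stateAt H K m (w.length / m) w).current

lemma ncard_presented_le (H : Set (Classifier X)) (K m : ℕ) (w : List X)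
    (hw : w.length = (blockLearner H K m).rounds) :
    ((blockLearner H K m).presented w).ncard ≤ K * (K + 1) := by
  have hsub : (blockLearner H K m).presented w ⊆
      (fun t => (stateAt H K m t w).current) '' Set.Iio (K * (K + 1)) := by
    rintro f ⟨s, hs, rfl⟩
    have hs' : s < K * (K + 1) * m := hs
    have hw' : w.length = K * (K + 1) * m := hw
    refine ⟨s / m, Nat.div_lt_of_lt_mul (by rwa [mul_comm]), ?_⟩
    have hlen : (w.take s).length = s := by simp; omega
    simp only [blockLearner, hlen]
    rw [stateAt_congr H K m (s / m) (w := w.take s) (v := w)]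
    rw [List.take_take, min_eq_left (Nat.div_mul_le_self s m)]
  calc _ ≤ ((fun t => (stateAt H K m t w).current) '' Set.Iio (K * (K + 1))).ncard :=
        Set.ncard_le_ncard hsub ((Set.finite_Iio _).image _)
    _ ≤ (Set.Iio (K * (K + 1))).ncard := Set.ncard_image_le (Set.finite_Iio _)
    _ = K * (K + 1) := by rw [Set.ncard_eq_toFinset_card']; simp

/-- With high probability, a sample from the error set of `f` is a net for this error set. -/
lemma exists_isErrorNet {H : Set (Classifier X)} {d : ℕ} (hd : vcDim H ≤ d)
    {D : Measure X} [IsProbabilityMeasure D] (hHD : SampleMeasurable H D) (h f : Classifier X)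
    (hf : D (errorSet h f) ≠ 0) {Q r m N : ℕ} (hQ : 0 < Q) (hr : 0 < r) (hm : m = 2 * Q * r)
    (hN : N * (2 * Q * ∑ k ∈ Finset.range (d + 1), (2 * m).choose k) ≤ 2 ^ r) :
    ∃ G : Set (Fin m → X), MeasurableSet G ∧
      1 - (N : ℝ≥0∞)⁻¹ ≤ (Measure.pi fun _ : Fin m => D[|errorSet h f]) G ∧
      ∀ x ∈ G, IsErrorNet D H h (1 / Q) f (counterexamples f (List.ofFn x)) := by
  have := cond_isProbabilityMeasure hf
  set P := D[|errorSet h f] with hP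
  have hE := measurableSet_errorSet h f
  obtain ⟨G, hG, hGP, hGnet⟩ := exists_measurableSet_consistent hd
    (hHD.absolutelyContinuous (cond_absolutelyContinuous (μ := D) (s := errorSet h f))) h hQ hr hm
  set μ := Measure.pi fun _ : Fin m => P
  have hae : ∀ᵐ x ∂μ, ∀ i, x i ∈ errorSet h f := by
    rw [ae_all_iff]
    intro i
    exact (measurePreserving_eval (fun _ : Fin m => P) i).quasiMeasurePreserving.ae
      (ae_cond_mem hE)
  have hset : MeasurableSet {x : Fin m → X | ∀ i, x i ∈ errorSet h f} := by
    have : {x : Fin m → X | ∀ i, x i ∈ errorSet h f} = ⋂ i, (fun x => x i) ⁻¹' errorSet h f := by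
      ext; simp
    rw [this]
    exact MeasurableSet.iInter fun i => measurable_pi_apply i hE
  -- Almost every sample lies in the error set; restricting to these makes the flipped labels of `f`
  -- correct.
  refine ⟨G ∩ {x | ∀ i, x i ∈ errorSet h f}, hG.inter hset, ?_, ?_⟩
  · rw [measure_inter_conull hae]
    have h1 : μ Gᶜ ≤ (N : ℝ≥0∞)⁻¹ := by
      rw [ENNReal.le_inv_iff_mul_le]
      have h2 : (μ Gᶜ * N) * 2 ^ r ≤ 1 * 2 ^ r := by
        calc (μ Gᶜ * N) * 2 ^ r = N * (μ Gᶜ * 2 ^ r) := by ring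
          _ ≤ N * (2 * Q * ∑ k ∈ Finset.range (d + 1), (2 * m).choose k : ℕ) := by gcongr
          _ ≤ 1 * 2 ^ r := by rw [one_mul]; exact_mod_cast hN
      exact (ENNReal.mul_le_mul_iff_left (by simp) (by finiteness)).1 h2
    rw [prob_compl_eq_one_sub hG] at h1
    exact tsub_le_iff_tsub_le.1 h1
  · rintro x ⟨hx, hxE⟩
    have hcorrect : ∀ i, h.1 (x i) = !f.1 (x i) := fun i => by
      have := hxE i
      simp only [errorSet, Set.mem_ofPred_eq] at this
      revert this
      cases f.1 (x i) <;> cases h.1 (x i) <;> simp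
    refine ⟨?_, fun g hg hgS => ?_⟩
    · simpa [counterexamples, List.mem_ofFn] using hcorrect
    · have h1 := hGnet x hx g hg fun i => by
        rw [hcorrect]
        exact hgS (x i, !f.1 (x i)) (List.mem_map.2 ⟨x i, List.mem_ofFn.2 ⟨i, rfl⟩, rfl⟩)
      have h2 : P.real (errorSet h g) ≤ 1 / Q := by
        have := ENNReal.toReal_mono (by simp; omega) h1
        simpa [Measure.real] using this
      have h3 : 0 < D.real (errorSet h f) := ENNReal.toReal_pos hf (by finiteness)
      rw [Measure.real, hP, cond_apply hE, ENNReal.toReal_mul, ENNReal.toReal_inv] at h2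
      change (D.real (errorSet h f))⁻¹ * D.real (errorSet h f ∩ errorSet h g) ≤ 1 / Q at h2
      rw [inv_mul_le_iff₀ h3] at h2
      linarith

/-- From a state that satisfies the invariant, the learner succeeds with at least the probability
that a net is drawn in each of the remaining blocks. -/
lemma pow_le_gameProbFrom {H : Set (Classifier X)} {D : Measure X} [IsProbabilityMeasure D]
    {h : Classifier X} (hH : h ∈ H) (A : Adversary X) {ε : ℝ} (hε : 0 ≤ ε) {K m : ℕ}
    (hK : 0 < K) (hKε : (1 / 4 : ℝ) ^ K ≤ ε / 4) (hm : 0 < m) {c : ℝ≥0∞} (hc : c ≤ 1)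
    (hnet : ∀ f : Classifier X, D (errorSet h f) ≠ 0 → ∃ G : Set (Fin m → X), MeasurableSet G ∧
      c ≤ (Measure.pi fun _ : Fin m => D[|errorSet h f]) G ∧
      ∀ x ∈ G, IsErrorNet D H h (1 / (4 * (K + 2))) f (counterexamples f (List.ofFn x))) :
    ∀ (n t : ℕ) (w : List X), t + n = K * (K + 1) → w.length = t * m →
      Invariant D H h ε K t (stateAt H K m t w) →
      c ^ n ≤ gameProbFrom (blockLearner H K m) A D (fun w =>
        risk D h ((blockLearner H K m).output w) ≤ ε ∨
        ∃ f ∈ (blockLearner H K m).presented w, ¬ A.IsStrong D h f) (n * m) w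
  | 0, t, w, ht, hw, hI => by
    have hr : risk D h ((blockLearner H K m).output w) ≤ ε := by
      rw [add_zero] at ht
      subst ht
      simp only [blockLearner, hw, Nat.mul_div_cancel _ hm]
      exact hI.risk_le hKε hε
    simp [gameProbFrom, hr]
  | n + 1, t, w, ht, hw, hI => by
    set f := (stateAt H K m t w).current with hf
    have hquery : ∀ v : List X, v.length < m → (blockLearner H K m).query (w ++ v) = f := by
      intro v hv
      have h1 : (w ++ v).length / m = t := by
        rw [List.length_append, hw, mul_comm, Nat.mul_add_div hm, Nat.div_eq_of_lt hv, add_zero]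
      simp only [blockLearner, h1]
      rw [hf, stateAt_congr H K m t (w := w ++ v) (v := w)]
      rw [← hw, List.take_left, List.take_length]
    have hrounds : (blockLearner H K m).rounds = t * m + (n + 1) * m := by
      simp only [blockLearner]
      rw [← ht, add_mul]
    by_cases hA : A.IsStrong D h f
    · obtain ⟨h0, hattack⟩ := hA.attack_eq
      obtain ⟨G, hG, hcG, hGnet⟩ := hnet f h0
      -- Samples outside `G` are counted as failures, which gives a measurable minorant.
      have key := lintegral_le_gameProbFrom (blockLearner H K m) A D (fun w =>
        risk D h ((blockLearner H K m).output w) ≤ ε ∨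
        ∃ f ∈ (blockLearner H K m).presented w, ¬ A.IsStrong D h f) f (n * m) m w hquery
        (G.indicator fun _ => c ^ n) (measurable_const.indicator hG) (by
          intro x
          by_cases hx : x ∈ G
          · rw [Set.indicator_of_mem hx]
            refine pow_le_gameProbFrom hH A hε hK hKε hm hc hnet n (t + 1) _ (by omega) ?_ ?_
            · simp [hw, add_mul]
            · have hs : stateAt H K m (t + 1) (w ++ List.ofFn x) =
                  step H K t (stateAt H K m t w) (List.ofFn x) := by
                rw [stateAt, stateAt_congr H K m t (w := w ++ List.ofFn x) (v := w), ← hw,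
                  List.drop_left, List.take_of_length_le (by simp)]
                rw [← hw, List.take_left, List.take_length]
              rw [hs]
              exact hI.step hH hε hK hKε (hGnet x hx)
          · simp [hx])
      rw [lintegral_indicator_const hG, hattack] at key
      rw [Nat.succ_mul, add_comm (n * m), pow_succ]
      exact le_trans (by gcongr) key
    · rw [gameProbFrom_eq_one]
      · exact pow_le_one₀ zero_le hc
      · intro v hv
        refine Or.inr ⟨f, ⟨w.length, ?_, ?_⟩, hA⟩
        · rw [Set.mem_Iio, hrounds, hw]
          have : 0 < (n + 1) * m := by positivity
          omega
        · simpa using hquery [] hm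

/-- Two distinct members would shatter a point where they differ. -/
lemma eq_of_vcDim_eq_zero {H : Set (Classifier X)} (hd : vcDim H ≤ (0 : ℕ)) {g h : Classifier X}
    (hg : g ∈ H) (hh : h ∈ H) : g = h := by
  by_contra hne
  obtain ⟨x, hx⟩ : ∃ x, g.1 x ≠ h.1 x := by
    by_contra! hall
    exact hne (Subtype.ext (funext hall))
  have : Shatters H {x} := by
    intro b
    by_cases hb : g.1 x = b x
    · exact ⟨g, hg, by simpa using hb⟩
    · refine ⟨h, hh, ?_⟩
      simp only [Finset.mem_singleton, forall_eq]
      revert hx hb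
      cases g.1 x <;> cases h.1 x <;> cases b x <;> simp
  simpa using card_le_of_shatters hd this

/-- Bernoulli's inequality. -/
lemma two_thirds_le_pow {N : ℕ} (hN : 0 < N) :
    2 / 3 ≤ (1 - ((3 * N : ℕ) : ℝ≥0∞)⁻¹) ^ N := by
  have hN' : (1 : ℝ) ≤ N := by exact_mod_cast hN
  have h1 : (2 / 3 : ℝ) ≤ (1 - ((3 * N : ℕ) : ℝ)⁻¹) ^ N := by
    have h2 := one_add_mul_le_pow (a := -((3 * N : ℕ) : ℝ)⁻¹) (by
      have : ((3 * N : ℕ) : ℝ)⁻¹ ≤ 1 := inv_le_one_of_one_le₀ (by push_cast; linarith)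
      linarith) N
    refine le_trans (le_of_eq ?_) h2
    push_cast
    field_simp
    norm_num
  have h3 : (1 - ((3 * N : ℕ) : ℝ≥0∞)⁻¹) = ENNReal.ofReal (1 - ((3 * N : ℕ) : ℝ)⁻¹) := by
    rw [ENNReal.ofReal_sub _ (by positivity), ENNReal.ofReal_one,
      ENNReal.ofReal_inv_of_pos (by push_cast; linarith), ENNReal.ofReal_natCast]
  have h0 : (0 : ℝ) ≤ 1 - ((3 * N : ℕ) : ℝ)⁻¹ := by
    have : ((3 * N : ℕ) : ℝ)⁻¹ ≤ 1 := inv_le_one_of_one_le₀ (by push_cast; linarith)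
    linarith
  rw [h3, ← ENNReal.ofReal_pow h0]
  refine le_trans (le_of_eq ?_) (ENNReal.ofReal_le_ofReal h1)
  rw [ENNReal.ofReal_div_of_pos (by norm_num)]
  norm_num

end Learner

end AdvLearning

/-! ### Choice of the parameters. -/

theorem mainTheorem2 :
    ∃ (C : ℝ) (k : ℕ), 0 < C ∧
      ∀ (X : Type u) [MeasurableSpace X] (ε : ℝ), 0 < ε → ε < 1 / 32 →
        ∀ (d : ℕ) (H : Set (AdvLearning.Classifier X)), AdvLearning.vcDim H = (d : ℕ∞) →
          ∃ L : AdvLearning.Learner X,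
            (L.rounds : ℝ) ≤ C * d * (Real.logb 2 (1 / ε)) ^ k ∧
            (∀ w : List X, w.length = L.rounds →
              ((L.presented w).ncard : ℝ) ≤ C * (Real.logb 2 (1 / ε)) ^ k) ∧
            ∀ (D : Measure X) [IsProbabilityMeasure D], AdvLearning.SampleMeasurable H D →
              ∀ h ∈ H, ∀ A : AdvLearning.Adversary X,
                2 / 3 ≤ AdvLearning.gameProb L A D (fun w =>
                  AdvLearning.risk D h (L.output w) ≤ ε ∨
                  ∃ f ∈ L.presented w, ¬ A.IsStrong D h f) := by
  -- There are `80 * d * K * (K + 1) * (K + 2) * K` rounds, and each of the last four factors is at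
  -- most `2 * ℓ`; `1280 = 80 * 2 ^ 4`.
  refine ⟨1280, 4, by norm_num, ?_⟩
  intro X _ ε hε hε' d H hd
  set ℓ := Real.logb 2 (1 / ε)
  have hεℓ : (2 : ℝ) ^ ℓ = 1 / ε :=
    Real.rpow_logb (by norm_num) (by norm_num) (by positivity)
  have hℓ : 5 < ℓ := by
    rw [Real.lt_logb_iff_rpow_lt (by norm_num) (by positivity), lt_one_div (by positivity) hε]
    norm_num
    linarith
  -- For `d = 0` no round is allowed, but a nonempty `H` is then a singleton and its member can be
  -- declared at once.
  rcases Nat.eq_zero_or_pos d with rfl | hd0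
  · refine ⟨⟨0, fun _ => AdvLearning.falseClassifier X, fun _ => AdvLearning.erm H []⟩, by simp,
      fun w _ => ?_, fun D _ _ h hh A => ?_⟩
    · simp only [AdvLearning.Learner.presented]
      rw [show Set.Iio 0 = (∅ : Set ℕ) by ext; simp]
      simp only [Set.image_empty, Set.ncard_empty, Nat.cast_zero]
      positivity
    · have h1 : AdvLearning.erm H [] = h :=
        AdvLearning.eq_of_vcDim_eq_zero hd.le (AdvLearning.erm_spec hh (by simp)).1 hh
      have h2 : AdvLearning.risk D h h ≤ ε := by
        simp [AdvLearning.risk, AdvLearning.errorSet, hε.le]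
      simp only [AdvLearning.gameProb, AdvLearning.gameProbFrom, h1, h2, true_or, if_true]
      rw [ENNReal.div_le_iff (by norm_num) (by norm_num)]
      norm_num
  · set K := ⌈ℓ⌉₊
    have hK5 : 5 ≤ K := by
      have : (5 : ℝ) < K := hℓ.trans_le (Nat.le_ceil ℓ)
      exact_mod_cast this.le
    have hKℓ : (K : ℝ) ≤ ℓ + 1 := (Nat.ceil_lt_add_one (by linarith)).le
    have hKε : (1 / 4 : ℝ) ^ K ≤ ε / 4 := by
      have h1 : 1 / ε ≤ (2 : ℝ) ^ K := by
        rw [← hεℓ, ← Real.rpow_natCast]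
        exact Real.rpow_le_rpow_of_exponent_le (by norm_num) (Nat.le_ceil ℓ)
      have h2 : (1 / 2 : ℝ) ^ K ≤ ε := by
        rw [one_div, inv_pow]
        exact inv_le_of_inv_le₀ hε (by rwa [← one_div])
      calc (1 / 4 : ℝ) ^ K = (1 / 2) ^ K * (1 / 2) ^ K := by rw [← mul_pow]; norm_num
        _ ≤ ε * ε := by gcongr
        _ ≤ ε / 4 := by nlinarith
    set m := 2 * (4 * (K + 2)) * (10 * K * d) with hm
    have hm0 : 0 < m := by positivity
    refine ⟨AdvLearning.blockLearner H K m, ?_, fun w hw => ?_, fun D _ hHD h hh A => ?_⟩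
    · have e : ((AdvLearning.blockLearner H K m).rounds : ℝ) =
          80 * d * (K * (K + 1) * (K + 2) * K) := by
        simp only [AdvLearning.blockLearner, hm]
        push_cast
        ring
      rw [e]
      calc (80 * d * (K * (K + 1) * (K + 2) * K) : ℝ)
          ≤ 80 * d * ((2 * ℓ) * (2 * ℓ) * (2 * ℓ) * (2 * ℓ)) := by gcongr <;> linarith
        _ = 1280 * d * ℓ ^ 4 := by ring
    · calc (((AdvLearning.blockLearner H K m).presented w).ncard : ℝ)
          ≤ ((K * (K + 1) : ℕ) : ℝ) := by
            exact_mod_cast AdvLearning.ncard_presented_le H K m w hw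
        _ = K * (K + 1) * 1 * 1 := by push_cast; ring
        _ ≤ (2 * ℓ) * (2 * ℓ) * (2 * ℓ) * (2 * ℓ) := by gcongr <;> linarith
        _ ≤ 1280 * ℓ ^ 4 := by nlinarith [pow_pos (by linarith : 0 < ℓ) 4]
    · refine (AdvLearning.two_thirds_le_pow (N := K * (K + 1)) (by positivity)).trans ?_
      refine AdvLearning.pow_le_gameProbFrom hh A hε.le (by omega) hKε hm0 tsub_le_self ?_
        (K * (K + 1)) 0 [] (by simp) (by simp) ?_
      · intro f hf
        have := AdvLearning.exists_isErrorNet hd.le hHD h f hf (Q := 4 * (K + 2))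
          (r := 10 * K * d) (m := m) (N := 3 * (K * (K + 1))) (by positivity) (by positivity) hm
          (AdvLearning.sampleSize_bound hK5 hd0)
        simpa using this
      -- Initially the trivial bound 1 on the risk suffices, as `phaseBound ε 0 = 1 + ε / 2`.
      · refine ⟨0, Or.inl ⟨by simp, measureReal_le_one.trans ?_⟩⟩
        unfold AdvLearning.phaseBound
        simp only [pow_zero]
        linarith
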